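/- Let $S$ be a Gorenstein local ring (a Noetherian local ring of finite injective dimension as a module over itself), let $r \ge 0$, and let $I = (v_1, \dots, v_r) \subset J = (w_1, \dots, w_{r+1})$ be ideals of $S$ such that $v_1, \dots, v_r$ and $w_1, \dots, w_{r+1}$ are regular sequences (so $I$ and $J$ have codimensions $r$ and $r+1$). Let $Q$ be any $r \times (r+1)$ matrix over $S$ with $$\begin{pmatrix} v_1 \\ \vdots \\ v_r \end{pmatrix} = Q \begin{pmatrix} w_1 \\ \vdots \\ w_{r+1} \end{pmatrix},$$ and for $1 \le i \le r+1$ let $g_i \in S$ be $(-1)^{i+1}$ times the determinant of the $r \times r$ matrix obtained from $Q$ by removing its $i$-th column. Then there is a unique $S/I$-linear map $s \colon J/I \to S/I$ sending the class of $w_i$ to the class of $g_i$ for all $1 \le i \le r+1$, and the $S/I$-module $\operatorname{Hom}_{S/I}(J/I, S/I)$ is generated by the two elements $\mathrm{id}$ and $s$, where $\mathrm{id} \colon J/I \to S/I$ is the inclusion. -/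

import Mathlib

universe u

/-- A Gorenstein local ring: a Noetherian local ring which has finite injective dimension as a
module over itself. -/
class IsGorensteinLocalRing (S : Type u) [CommRing S] : Prop extends
    IsLocalRing S, IsNoetherianRing S where
  exists_hasInjectiveDimensionLE :
    ∃ n : ℕ, CategoryTheory.HasInjectiveDimensionLE (ModuleCat.of S S) n

/-- The signed maximal minors of an `r × (r + 1)` matrix `Q`: the `i`-th one is the determinant of
the matrix obtained by removing the `i`-th column, with sign `(-1) ^ i` for columns counted from
`0` (that is, `(-1) ^ (i + 1)` for columns counted from `1`). -/
def signedMaximalMinors {S : Type u} [CommRing S] {r : ℕ}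
    (Q : Matrix (Fin r) (Fin (r + 1)) S) (i : Fin (r + 1)) : S :=
  (-1) ^ (i : ℕ) * (Q.submatrix id i.succAbove).det

/-- `J/I`, as an ideal (hence a submodule) of the quotient ring `S/I`. -/
abbrev quotientIdeal {S : Type u} [CommRing S] (I J : Ideal S) : Ideal (S ⧸ I) :=
  J.map (Ideal.Quotient.mk I)

/-- The class in `J/I` of an element of `J`. -/
def quotientIdealMk {S : Type u} [CommRing S] (I : Ideal S) {J : Ideal S} (x : J) :
    quotientIdeal I J :=
  ⟨Ideal.Quotient.mk I x, Ideal.mem_map_of_mem _ x.2⟩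

/-!
The argument uses only that `S` is a Noetherian local ring.

Its core is Wiebe's theorem (`mem_span_sup_det_smul_top_of_colon`): if `(a) ⊆ (b)` are generated by
regular sequences of the same length and `a = M b`, then `(a) : (b) = (a) + (det M)`. It is proved
for sequences on a finite module `N` by induction on the length. Write `a'` for `a` without its
last entry `p`. By prime avoidance the last generator of `(b)` can be changed, by a unipotent
substitution, to an element `c` that is regular modulo `a' N`. Since `p` and `c` are both regular
modulo `a' N`, the colons of `(b)` into `(a', p) N` and `(a', c) N` correspond to each other via
`c y ≡ p z` (`exists_smul_sub_smul_mem_of_colon`); the second one is computed in `N / c N` by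
induction, and Cramer's rule translates the answer back. The same induction shows that `J`, being
generated by a longer regular sequence than `I`, kills no nonzero element of `S/I`
(`mem_span_smul_top_of_colon`), so that `J` contains an element `x` which is regular on `S/I`
(`exists_isSMulRegular_quotient`).

Write `x = ∑ qⱼ wⱼ` and let `M` be the matrix `Q` with the row `q` added at the bottom, so that
`M w = (v, x)`. Cramer's rule gives `det M * wᵢ ≡ (-1)ʳ gᵢ x` modulo `I`, so
`u ↦ (-1)ʳ det M * u / x` is the required map `s`. A linear map `φ : J/I → S/I` is determined by
`y = φ x`, and `x φ(u) = u y` shows `y ∈ (v, x) : J`. By Wiebe's theorem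
`y = α x + β det M` modulo `I`, which says `φ = α id + (-1)ʳ β s`.
-/

open RingTheory.Sequence Submodule IsLocalRing
open scoped Pointwise

/-! ### Prime avoidance and regular elements -/

/-- Prime avoidance for a coset: if no prime of the finite set `T` contains both `x` and `I`, then
some element of `x + I` lies in none of them. -/
theorem Ideal.exists_add_notMem_of_finset {R : Type*} [CommRing R] (I : Ideal R) (x : R)
    (T : Finset (Ideal R)) (hT : ∀ P ∈ T, P.IsPrime) (h : ∀ P ∈ T, x ∈ P → ¬ I ≤ P) :
    ∃ y ∈ I, ∀ P ∈ T, x + y ∉ P := by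
  classical
  induction T using Finset.strongInduction with
  | H T ih =>
    obtain rfl | hne := T.eq_empty_or_nonempty
    · exact ⟨0, I.zero_mem, by simp⟩
    obtain ⟨P, hP⟩ := T.exists_minimal hne
    have hPT : P ∈ T := hP.prop
    have := hT P hPT
    obtain ⟨y, hyI, hy⟩ := ih (T.erase P) (Finset.erase_ssubset hPT)
      (fun Q hQ ↦ hT Q (Finset.mem_of_mem_erase hQ))
      (fun Q hQ ↦ h Q (Finset.mem_of_mem_erase hQ))
    by_cases hxy : x + y ∈ P
    · have hIP : ¬ I ≤ P := fun hIP ↦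
        h P hPT ((Ideal.add_mem_iff_left P (hIP hyI)).mp hxy) hIP
      -- By minimality `P` contains no other member of `T`, so some `z ∈ I` lies in all of them but
      -- not in `P`; adding `z` moves `x + y` out of `P` and changes nothing modulo the other primes.
      have hprod : ¬ I * ∏ Q ∈ T.erase P, Q ≤ P := by
        rw [this.mul_le, not_or]
        refine ⟨hIP, fun hle ↦ ?_⟩
        obtain ⟨Q, hQ, hQP⟩ := (Ideal.IsPrime.prod_le (f := fun Q ↦ Q) this).mp hle
        have hQT := Finset.mem_erase.mp hQ
        exact hQT.1 (le_antisymm hQP (hP.le_of_le hQT.2 hQP))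
      obtain ⟨z, hz, hzP⟩ := SetLike.not_le_iff_exists.mp hprod
      have hzI : z ∈ I := (Ideal.mul_le_left : I * ∏ Q ∈ T.erase P, Q ≤ I) hz
      have hzT : z ∈ ∏ Q ∈ T.erase P, Q := (Ideal.mul_le_right : I * _ ≤ ∏ Q ∈ T.erase P, Q) hz
      refine ⟨y + z, I.add_mem hyI hzI, fun Q hQ hmem ↦ ?_⟩
      rw [← add_assoc] at hmem
      by_cases hQP : Q = P
      · subst hQP
        exact hzP ((Ideal.add_mem_iff_right Q hxy).mp hmem)
      · have hQ' := Finset.mem_erase.mpr ⟨hQP, hQ⟩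
        have hle : ∏ Q ∈ T.erase P, Q ≤ Q :=
          Ideal.prod_le_inf.trans (Finset.inf_le (f := fun Q ↦ Q) hQ')
        have hzQ : z ∈ Q := hle hzT
        exact hy Q hQ' ((Ideal.add_mem_iff_left Q hzQ).mp hmem)
    · refine ⟨y, hyI, fun Q hQ ↦ ?_⟩
      by_cases hQP : Q = P
      · rwa [hQP]
      · exact hy Q (Finset.mem_erase.mpr ⟨hQP, hQ⟩)

/-- If the ideal `(x) + I` contains a regular element on `M`, then so does the coset `x + I`. -/
theorem exists_isSMulRegular_add_of_mem_sup {R M : Type*} [CommRing R] [IsNoetherianRing R]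
    [AddCommGroup M] [Module R M] [Module.Finite R M] (I : Ideal R) (x : R) {j : R}
    (hj : j ∈ Ideal.span {x} ⊔ I) (hreg : IsSMulRegular M j) :
    ∃ y ∈ I, IsSMulRegular M (x + y) := by
  have hfin := associatedPrimes.finite R M
  have hunion := biUnion_associatedPrimes_eq_compl_regular R M
  have key : ∀ z : R, (∀ P ∈ associatedPrimes R M, z ∉ P) ↔ IsSMulRegular M z := by
    intro z
    have := Set.ext_iff.mp hunion z
    simp only [Set.mem_iUnion, SetLike.mem_coe, Set.mem_compl_iff, Set.mem_ofPred_eq] at this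
    rw [← not_iff_not, ← this]
    simp
  obtain ⟨y, hy, hyP⟩ := I.exists_add_notMem_of_finset x hfin.toFinset
    (fun P hP ↦ IsAssociatedPrime.isPrime (hfin.mem_toFinset.mp hP))
    (fun P hP hx hI ↦ (key j).mpr hreg P (hfin.mem_toFinset.mp hP)
      (sup_le ((Ideal.span_singleton_le_iff_mem P).mpr hx) hI hj))
  exact ⟨y, hy, (key _).mp fun P hP ↦ hyP P (hfin.mem_toFinset.mpr hP)⟩

theorem Ideal.ofList_ofFn {R : Type*} [CommRing R] {n : ℕ} (a : Fin n → R) :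
    Ideal.ofList (List.ofFn a) = Ideal.span (Set.range a) := by
  exact congrArg Ideal.span (Set.ext fun x ↦ List.mem_ofFn)

/-! ### Weakly regular sequences and quotients -/

section

variable {S : Type*} [CommRing S] {N : Type*} [AddCommGroup N] [Module S N]

theorem Submodule.mem_sup_span_singleton_smul_top_iff (I : Ideal S) (p : S) (y : N) :
    y ∈ ((I ⊔ Ideal.span {p}) • ⊤ : Submodule S N) ↔
      ∃ z : N, y - p • z ∈ (I • ⊤ : Submodule S N) := by
  rw [sup_smul, ideal_span_singleton_smul, Submodule.mem_sup]
  constructor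
  · rintro ⟨k, hk, q, hq, rfl⟩
    obtain ⟨z, -, rfl⟩ := (mem_smul_pointwise_iff_exists _ _ _).mp hq
    exact ⟨z, by simpa using hk⟩
  · rintro ⟨z, hz⟩
    exact ⟨_, hz, p • z, smul_mem_pointwise_smul _ _ _ mem_top, by simp⟩

theorem QuotSMulTop.mkQ_mem_smul_top_iff (I : Ideal S) (c : S) (z : N) :
    ((c • ⊤ : Submodule S N).mkQ z : QuotSMulTop c N) ∈
        (I • ⊤ : Submodule S (QuotSMulTop c N)) ↔
      z ∈ ((I ⊔ Ideal.span {c}) • ⊤ : Submodule S N) := by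
  have h : (I • ⊤ : Submodule S (QuotSMulTop c N)) =
      Submodule.map (c • ⊤ : Submodule S N).mkQ (I • ⊤) := by
    rw [Submodule.map_smul'', Submodule.map_top, range_mkQ]
  rw [h, ← Submodule.mem_comap, Submodule.comap_map_mkQ, sup_smul, ideal_span_singleton_smul,
    sup_comm]

theorem isWeaklyRegular_ofFn_succ_last_iff {n : ℕ} (a : Fin (n + 1) → S) :
    IsWeaklyRegular N (List.ofFn a) ↔
      IsWeaklyRegular N (List.ofFn fun i : Fin n ↦ a i.castSucc) ∧
        IsSMulRegular (N ⧸ (Ideal.span (Set.range fun i : Fin n ↦ a i.castSucc) • ⊤ :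
          Submodule S N)) (a (Fin.last n)) := by
  rw [List.ofFn_succ', List.concat_eq_append, isWeaklyRegular_append_iff,
    isWeaklyRegular_singleton_iff, Ideal.ofList_ofFn]

/-- In the local case `c` can be moved from the end of the sequence `(a, c)` to its beginning. -/
theorem isWeaklyRegular_quotSMulTop_of_isSMulRegular [IsLocalRing S] [IsNoetherian S N] {n : ℕ}
    {a : Fin n → S} {c : S} (ha : IsWeaklyRegular N (List.ofFn a))
    (hc : IsSMulRegular (N ⧸ (Ideal.span (Set.range a) • ⊤ : Submodule S N)) c)
    (ham : ∀ i, a i ∈ maximalIdeal S) (hcm : c ∈ maximalIdeal S) :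
    IsSMulRegular N c ∧ IsWeaklyRegular (QuotSMulTop c N) (List.ofFn a) := by
  have h : IsWeaklyRegular N (List.ofFn a ++ [c]) := by
    rw [isWeaklyRegular_append_iff, isWeaklyRegular_singleton_iff, Ideal.ofList_ofFn]
    exact ⟨ha, hc⟩
  have h' := IsLocalRing.isWeaklyRegular_of_perm_of_subset_maximalIdeal h
    (List.perm_append_comm (l₂ := [c])) (by
      intro r hr
      simp only [List.mem_append, List.mem_ofFn, List.mem_singleton] at hr
      rcases hr with ⟨i, rfl⟩ | rfl
      exacts [ham i, hcm])
  simpa using h'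

/-- Let `p` be regular modulo `K N` and let `J` multiply `y` into `(K, p) N`. For every
`c ∈ J` there is `z` with `c y ≡ p z` modulo `K N`, and then `J` multiplies `z` into `(K, c) N`. -/
theorem exists_smul_sub_smul_mem_of_colon {K : Ideal S} {J : Ideal S} {p c : S} {y : N}
    (hp : IsSMulRegular (N ⧸ (K • ⊤ : Submodule S N)) p)
    (hcJ : c ∈ J) (hy : ∀ b ∈ J, b • y ∈ ((K ⊔ Ideal.span {p}) • ⊤ : Submodule S N)) :
    ∃ z : N, c • y - p • z ∈ (K • ⊤ : Submodule S N) ∧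
      ∀ b ∈ J, b • z ∈ ((K ⊔ Ideal.span {c}) • ⊤ : Submodule S N) := by
  rw [isSMulRegular_quotient_iff_mem_of_smul_mem] at hp
  obtain ⟨z, hz⟩ := (mem_sup_span_singleton_smul_top_iff _ _ _).mp (hy c hcJ)
  refine ⟨z, hz, fun b hb ↦ ?_⟩
  obtain ⟨q, hq⟩ := (mem_sup_span_singleton_smul_top_iff _ _ _).mp (hy b hb)
  refine (mem_sup_span_singleton_smul_top_iff _ _ _).mpr ⟨q, hp _ ?_⟩
  have : p • (b • z - c • q) = c • (b • y - p • q) - b • (c • y - p • z) := by module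
  rw [this]
  exact sub_mem (smul_mem _ _ hq) (smul_mem _ _ hz)

/-- The last entry of a weakly regular sequence `b` can be replaced by an element `c` of its coset
modulo the other entries such that `c` is regular on `N / K N`, provided that `(b)` contains an
element that is regular there. The element is only required to act on `N` as some `p` does: after
passing to a quotient of `N`, inclusions between ideals survive only up to the annihilator. -/
theorem exists_regular_last_generator [IsLocalRing S] [IsNoetherianRing S] [Module.Finite S N]
    {n : ℕ} {b : Fin (n + 1) → S} (hb : IsWeaklyRegular N (List.ofFn b))
    (hbm : ∀ i, b i ∈ maximalIdeal S) (K : Ideal S) {p : S}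
    (hp : IsSMulRegular (N ⧸ (K • ⊤ : Submodule S N)) p)
    (hpJ : ∃ j ∈ Ideal.span (Set.range b), ∀ z : N, p • z = j • z) :
    ∃ t : Fin n → S, ∃ c : S, c = b (Fin.last n) + ∑ i, t i * b i.castSucc ∧
      c ∈ Ideal.span (Set.range b) ∧ c ∈ maximalIdeal S ∧
      IsSMulRegular (N ⧸ (K • ⊤ : Submodule S N)) c ∧
      IsWeaklyRegular (QuotSMulTop c N) (List.ofFn fun i : Fin n ↦ b i.castSucc) := by
  obtain ⟨j, hj, hpj⟩ := hpJ
  set I : Ideal S := Ideal.span (Set.range fun i : Fin n ↦ b i.castSucc) with hI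
  have hIJ : I ≤ Ideal.span (Set.range b) :=
    Ideal.span_mono (by rintro _ ⟨i, rfl⟩; exact ⟨_, rfl⟩)
  have hJ : Ideal.span (Set.range b) ≤ Ideal.span {b (Fin.last n)} ⊔ I := by
    rw [Ideal.span_le]
    rintro _ ⟨i, rfl⟩
    induction i using Fin.lastCases with
    | last => exact mem_sup_left (Ideal.mem_span_singleton_self _)
    | cast i => exact mem_sup_right (Ideal.subset_span ⟨i, rfl⟩)
  have hjreg : IsSMulRegular (N ⧸ (K • ⊤ : Submodule S N)) j := by
    rw [isSMulRegular_quotient_iff_mem_of_smul_mem] at hp ⊢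
    intro z hz
    exact hp z (by rwa [hpj])
  obtain ⟨u, hu, hreg⟩ := exists_isSMulRegular_add_of_mem_sup I (b (Fin.last n)) (hJ hj) hjreg
  obtain ⟨t, ht⟩ := Ideal.mem_span_range_iff_exists_fun.mp hu
  have hcJ : b (Fin.last n) + u ∈ Ideal.span (Set.range b) :=
    add_mem (Ideal.subset_span ⟨_, rfl⟩) (hIJ hu)
  have hJm : Ideal.span (Set.range b) ≤ maximalIdeal S :=
    Ideal.span_le.mpr (by rintro _ ⟨i, rfl⟩; exact hbm i)
  refine ⟨t, b (Fin.last n) + u, by rw [ht], hcJ, hJm hcJ, hreg, ?_⟩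
  rw [isWeaklyRegular_ofFn_succ_last_iff, ← hI] at hb
  refine (isWeaklyRegular_quotSMulTop_of_isSMulRegular hb.1 ?_ (fun i ↦ hbm _) (hJm hcJ)).2
  have hb2 := hb.2
  rw [isSMulRegular_quotient_iff_mem_of_smul_mem] at hb2 ⊢
  intro z hz
  refine hb2 z ?_
  rw [add_smul] at hz
  exact (add_mem_cancel_right (smul_mem_smul hu mem_top)).mp hz

theorem Ideal.span_range_le_of_eq_last_add {n : ℕ} {b : Fin (n + 1) → S} {t : Fin n → S} {c : S}
    (hc : c = b (Fin.last n) + ∑ i, t i * b i.castSucc) :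
    Ideal.span (Set.range b) ≤
      Ideal.span (Set.range fun i : Fin n ↦ b i.castSucc) ⊔ Ideal.span {c} := by
  have h : ∀ i : Fin n, b i.castSucc ∈ Ideal.span (Set.range fun i : Fin n ↦ b i.castSucc) :=
    fun i ↦ Ideal.subset_span ⟨i, rfl⟩
  rw [Ideal.span_le]
  rintro _ ⟨i, rfl⟩
  induction i using Fin.lastCases with
  | last =>
    have : b (Fin.last n) = c - ∑ i, t i * b i.castSucc := by rw [hc]; ring
    rw [this]
    exact sub_mem (mem_sup_right (Ideal.mem_span_singleton_self c))
      (mem_sup_left (Ideal.sum_mem _ fun i _ ↦ Ideal.mul_mem_left _ _ (h i)))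
  | cast i => exact mem_sup_left (h i)

theorem Ideal.span_range_succ_last {n : ℕ} (a : Fin (n + 1) → S) :
    Ideal.span (Set.range a) =
      Ideal.span (Set.range fun i : Fin n ↦ a i.castSucc) ⊔ Ideal.span {a (Fin.last n)} := by
  refine le_antisymm (Ideal.span_range_le_of_eq_last_add (t := 0) (by simp)) (sup_le ?_ ?_)
  · exact Ideal.span_mono (by rintro _ ⟨i, rfl⟩; exact ⟨_, rfl⟩)
  · exact Ideal.span_mono (by rintro _ rfl; exact ⟨_, rfl⟩)

theorem QuotSMulTop.self_smul (c : S) (y : QuotSMulTop c N) : c • y = 0 := by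
  obtain ⟨y, rfl⟩ := mkQ_surjective _ y
  rw [← map_smul]
  exact (Submodule.Quotient.mk_eq_zero _).mpr (smul_mem_pointwise_smul _ _ _ mem_top)

end

/-! ### Colons of ideals generated by regular sequences -/

/-- If `(v) ⊆ (w)`, up to the annihilator of `N`, and `w` is the longer of the two sequences, then
no nonzero element of `N / (v) N` is killed by `(w)`. -/
theorem mem_span_smul_top_of_colon {S : Type*} [CommRing S] [IsLocalRing S] [IsNoetherianRing S]
    {r : ℕ} {N : Type*} [AddCommGroup N] [Module S N] [Module.Finite S N]
    {v : Fin r → S} {w : Fin (r + 1) → S}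
    (hv : IsWeaklyRegular N (List.ofFn v)) (hw : IsWeaklyRegular N (List.ofFn w))
    (hvm : ∀ i, v i ∈ maximalIdeal S) (hwm : ∀ i, w i ∈ maximalIdeal S)
    (hvw : ∀ i, ∃ j ∈ Ideal.span (Set.range w), ∀ z : N, v i • z = j • z) {y : N}
    (hy : ∀ b ∈ Ideal.span (Set.range w), b • y ∈ (Ideal.span (Set.range v) • ⊤ : Submodule S N)) :
    y ∈ (Ideal.span (Set.range v) • ⊤ : Submodule S N) := by
  induction r generalizing N with
  | zero =>
    have h0 := hy (w 0) (Ideal.subset_span ⟨0, rfl⟩)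
    simp only [Set.range_eq_empty, Ideal.span_empty, Submodule.bot_smul, Submodule.mem_bot]
      at h0 ⊢
    have hreg : IsSMulRegular N (w 0) := by simpa using hw
    exact hreg.right_eq_zero_of_smul h0
  | succ r ih =>
    rw [isWeaklyRegular_ofFn_succ_last_iff] at hv
    obtain ⟨hv', hp⟩ := hv
    obtain ⟨t, c, hc, hcJ, hcm, hcreg, hw'⟩ :=
      exists_regular_last_generator hw hwm _ hp (hvw _)
    have hJ := Ideal.span_range_le_of_eq_last_add hc
    rw [Ideal.span_range_succ_last v] at hy ⊢
    obtain ⟨z, hz, hzJ⟩ := exists_smul_sub_smul_mem_of_colon hp hcJ hy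
    have hvc := (isWeaklyRegular_quotSMulTop_of_isSMulRegular hv' hcreg (fun i ↦ hvm _) hcm).2
    have hzmem := ih (N := QuotSMulTop c N) hvc hw' (fun i ↦ hvm _) (fun i ↦ hwm _) (fun i ↦ by
        obtain ⟨j, hj, hji⟩ := hvw i.castSucc
        obtain ⟨k, hk, l, hl, rfl⟩ := Submodule.mem_sup.mp (hJ hj)
        obtain ⟨s, rfl⟩ := Ideal.mem_span_singleton'.mp hl
        refine ⟨k, hk, fun x ↦ ?_⟩
        obtain ⟨x, rfl⟩ := mkQ_surjective _ x
        rw [← map_smul, hji, map_smul, add_smul, mul_smul, QuotSMulTop.self_smul, smul_zero,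
          add_zero])
      (y := (c • ⊤ : Submodule S N).mkQ z) (fun b hb ↦ by
        rw [← map_smul]
        exact (QuotSMulTop.mkQ_mem_smul_top_iff _ _ _).mpr
          (hzJ b (Ideal.span_mono (by rintro _ ⟨i, rfl⟩; exact ⟨_, rfl⟩) hb)))
    obtain ⟨q, hq⟩ := (mem_sup_span_singleton_smul_top_iff _ _ _).mp
      ((QuotSMulTop.mkQ_mem_smul_top_iff _ _ _).mp hzmem)
    rw [isSMulRegular_quotient_iff_mem_of_smul_mem] at hcreg
    refine (mem_sup_span_singleton_smul_top_iff _ _ _).mpr ⟨q, hcreg _ ?_⟩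
    -- With `p` the last entry of `v`: `c y ≡ p z ≡ c p q` modulo the other entries; cancel `c`.
    have : c • (y - v (Fin.last r) • q) =
      (c • y - v (Fin.last r) • z) + v (Fin.last r) • (z - c • q) := by module
    rw [this]
    exact add_mem hz (smul_mem _ _ hq)

/-- Replacing the last entry of `b` by `c` is a unipotent substitution, so it changes the
coefficient matrix but not its determinant. -/
theorem Matrix.exists_det_eq_mulVec_eq {S : Type*} [CommRing S] {n : ℕ}
    (M : Matrix (Fin (n + 1)) (Fin (n + 1)) S) {b : Fin (n + 1) → S} {t : Fin n → S} {c : S}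
    (hc : c = b (Fin.last n) + ∑ i, t i * b i.castSucc) :
    ∃ M' : Matrix (Fin (n + 1)) (Fin (n + 1)) S, M'.det = M.det ∧
      M.mulVec b = M'.mulVec (Fin.snoc (fun i : Fin n ↦ b i.castSucc) c : Fin (n + 1) → S) := by
  let V : Matrix (Fin (n + 1)) (Fin (n + 1)) S :=
    Matrix.updateRow 1 (Fin.last n) (Fin.snoc (fun i ↦ - t i) 1 : Fin (n + 1) → S)
  have hV : V.det = 1 := by
    rw [Matrix.det_of_isLowerTriangular]
    · refine Finset.prod_eq_one fun i _ ↦ ?_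
      induction i using Fin.lastCases with
      | last => simp [V]
      | cast i => simp [V, Matrix.updateRow_apply, (Fin.castSucc_lt_last i).ne]
    · intro i j hij
      have hij : i < j := hij
      have hi : i ≠ Fin.last n := (hij.trans_le (Fin.le_last j)).ne
      simp [V, Matrix.updateRow_apply, hi, hij.ne]
  refine ⟨M * V, by rw [Matrix.det_mul, hV, mul_one], ?_⟩
  rw [← Matrix.mulVec_mulVec]
  congr 1
  ext i
  induction i using Fin.lastCases with
  | last =>
    simp [V, Matrix.mulVec, dotProduct, Fin.sum_univ_castSucc, hc]
  | cast i =>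
    simp [V, Matrix.mulVec, dotProduct, Matrix.updateRow_apply,
      (Fin.castSucc_lt_last i).ne, Matrix.one_apply]

/-- **Wiebe's theorem** for modules: if `a = M b`, up to the annihilator of `N`, then every
element of `N` that `(b)` multiplies into `(a) N` lies in `(a, det M) N`. -/
theorem mem_span_sup_det_smul_top_of_colon {S : Type*} [CommRing S] [IsLocalRing S]
    [IsNoetherianRing S]
    {n : ℕ} {N : Type*} [AddCommGroup N] [Module S N] [Module.Finite S N]
    {a b : Fin n → S} (M : Matrix (Fin n) (Fin n) S)
    (ha : IsWeaklyRegular N (List.ofFn a)) (hb : IsWeaklyRegular N (List.ofFn b))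
    (ham : ∀ i, a i ∈ maximalIdeal S) (hbm : ∀ i, b i ∈ maximalIdeal S)
    (hab : ∀ i, ∀ z : N, a i • z = M.mulVec b i • z) {y : N}
    (hy : ∀ x ∈ Ideal.span (Set.range b), x • y ∈ (Ideal.span (Set.range a) • ⊤ : Submodule S N)) :
    y ∈ ((Ideal.span (Set.range a) ⊔ Ideal.span {M.det}) • ⊤ : Submodule S N) := by
  induction n generalizing N with
  | zero => simp
  | succ n ih =>
    rw [isWeaklyRegular_ofFn_succ_last_iff] at ha
    obtain ⟨ha', hp⟩ := ha
    have hMb : ∀ i, M.mulVec b i ∈ Ideal.span (Set.range b) := by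
      intro i
      rw [Matrix.mulVec, dotProduct]
      exact Ideal.sum_mem _ fun j _ ↦ Ideal.mul_mem_left _ _
        (Ideal.subset_span (Set.mem_range_self j))
    obtain ⟨t, c, hc, hcJ, hcm, hcreg, hb'⟩ :=
      exists_regular_last_generator hb hbm _ hp ⟨_, hMb _, hab _⟩
    obtain ⟨M', hdet, hM'⟩ := M.exists_det_eq_mulVec_eq hc
    rw [← hdet]
    set b' : Fin (n + 1) → S := Fin.snoc (fun i : Fin n ↦ b i.castSucc) c with hb'def
    simp only [hM'] at hab
    rw [Ideal.span_range_succ_last a] at hy ⊢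
    obtain ⟨z, hz, hzJ⟩ := exists_smul_sub_smul_mem_of_colon hp hcJ hy
    have hac := (isWeaklyRegular_quotSMulTop_of_isSMulRegular ha' hcreg (fun i ↦ ham _) hcm).2
    have hzmem := ih (N := QuotSMulTop c N) (M'.submatrix Fin.castSucc Fin.castSucc)
      hac hb' (fun i ↦ ham _) (fun i ↦ hbm _) (fun i x ↦ by
        obtain ⟨x, rfl⟩ := mkQ_surjective _ x
        rw [← map_smul, hab, map_smul]
        simp [Matrix.mulVec, dotProduct, Fin.sum_univ_castSucc, hb'def, add_smul, mul_smul,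
          QuotSMulTop.self_smul])
      (y := (c • ⊤ : Submodule S N).mkQ z) (fun x hx ↦ by
        rw [← map_smul]
        exact (QuotSMulTop.mkQ_mem_smul_top_iff _ _ _).mpr
          (hzJ x (Ideal.span_mono (by rintro _ ⟨i, rfl⟩; exact ⟨_, rfl⟩) hx)))
    set δ := (M'.submatrix (Fin.castSucc : Fin n → _) Fin.castSucc).det with hδ
    set K : Ideal S := Ideal.span (Set.range fun i : Fin n ↦ a i.castSucc) with hK
    obtain ⟨β, hβ⟩ := (mem_sup_span_singleton_smul_top_iff _ _ _).mp hzmem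
    obtain ⟨β, rfl⟩ := mkQ_surjective _ β
    rw [← map_smul, ← map_sub, QuotSMulTop.mkQ_mem_smul_top_iff,
      mem_sup_span_singleton_smul_top_iff] at hβ
    obtain ⟨α, hα⟩ := hβ
    -- The last row of `adj(M') M' b' = det M' • b'`, read modulo `K`.
    have hcr : c • M'.det • β - a (Fin.last n) • δ • β ∈ (K • ⊤ : Submodule S N) := by
      have h1 : M'.det * c = ∑ i, M'.adjugate (Fin.last n) i * (M'.mulVec b') i := by
        have := congrFun (Matrix.mulVec_mulVec b' M'.adjugate M') (Fin.last n)
        rw [Matrix.adjugate_mul, Matrix.smul_mulVec, Matrix.one_mulVec] at this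
        simpa [hb'def, Matrix.mulVec, dotProduct] using this.symm
      have h2 : M'.adjugate (Fin.last n) (Fin.last n) = δ := by
        rw [Matrix.adjugate_fin_succ_eq_det_submatrix, hδ, Fin.succAbove_last, ← two_mul]
        simp
      have h3 : c • M'.det • β = ∑ i, M'.adjugate (Fin.last n) i • a i • β := by
        rw [← mul_smul, mul_comm, h1, Finset.sum_smul]
        exact Finset.sum_congr rfl fun i _ ↦ by rw [mul_smul, hab]
      rw [h3, Fin.sum_univ_castSucc, h2, smul_comm δ, add_sub_cancel_right]
      exact sum_mem fun i _ ↦ smul_mem _ _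
        (smul_mem_smul (Ideal.subset_span ⟨i, rfl⟩) mem_top)
    rw [isSMulRegular_quotient_iff_mem_of_smul_mem] at hcreg
    rw [mem_sup_span_singleton_smul_top_iff]
    refine ⟨β, (mem_sup_span_singleton_smul_top_iff _ _ _).mpr ⟨α, hcreg _ ?_⟩⟩
    -- With `p` the last entry of `a`: `c y ≡ p z ≡ p (c α + δ β) ≡ c (p α + det M' β)` modulo `K N`.
    have : c • (y - M'.det • β - a (Fin.last n) • α) =
      (c • y - a (Fin.last n) • z) + a (Fin.last n) • (z - δ • β - c • α)
        - (c • M'.det • β - a (Fin.last n) • δ • β) := by module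
    rw [this]
    exact sub_mem (add_mem hz (smul_mem _ _ hα)) hcr

/-! ### Homomorphisms from `J/I` to `S/I` -/

section

variable {S : Type*} [CommRing S]

theorem RingTheory.Sequence.IsRegular.mem_maximalIdeal [IsLocalRing S] {n : ℕ} {a : Fin n → S}
    (ha : IsRegular S (List.ofFn a)) (i : Fin n) : a i ∈ maximalIdeal S := by
  refine le_maximalIdeal (J := Ideal.span (Set.range a)) (fun h ↦ ha.top_ne_smul ?_)
    (Ideal.subset_span ⟨i, rfl⟩)
  rw [Ideal.ofList_ofFn, h, top_smul]

/-- An ideal generated by a regular sequence longer than `v` contains an element that is regular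
modulo `(v)`. -/
theorem exists_isSMulRegular_quotient [IsLocalRing S] [IsNoetherianRing S] {r : ℕ}
    {v : Fin r → S} {w : Fin (r + 1) → S}
    (hv : IsRegular S (List.ofFn v)) (hw : IsRegular S (List.ofFn w))
    (hvw : Ideal.span (Set.range v) ≤ Ideal.span (Set.range w)) :
    ∃ x ∈ Ideal.span (Set.range w), IsSMulRegular (S ⧸ Ideal.span (Set.range v)) x := by
  set I := Ideal.span (Set.range v) with hI
  set J := Ideal.span (Set.range w) with hJ
  -- Such an element exists as soon as `Hom(S/J, S/I) = 0`, that is, no nonzero element of `S/I` is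
  -- killed by `J`.
  have hsub : Subsingleton ((S ⧸ J) →ₗ[S] S ⧸ I) := by
    refine subsingleton_of_forall_eq 0 fun f ↦ ?_
    obtain ⟨y, hy⟩ := Ideal.Quotient.mk_surjective (f 1)
    have hyI : y ∈ (I • ⊤ : Submodule S S) := by
      refine mem_span_smul_top_of_colon hv.toIsWeaklyRegular hw.toIsWeaklyRegular
        hv.mem_maximalIdeal hw.mem_maximalIdeal
        (fun i ↦ ⟨v i, hvw (Ideal.subset_span ⟨i, rfl⟩), fun _ ↦ rfl⟩) fun b hb ↦ ?_
      rw [smul_eq_mul, Ideal.mul_top, ← hI, smul_eq_mul, ← Ideal.Quotient.eq_zero_iff_mem, map_mul,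
        hy]
      have h0 : b • (1 : S ⧸ J) = 0 := by
        rw [Algebra.smul_def, mul_one]
        exact Ideal.Quotient.eq_zero_iff_mem.mpr hb
      have := f.map_smul b 1
      rw [h0, map_zero, Algebra.smul_def] at this
      exact this.symm
    rw [smul_eq_mul, Ideal.mul_top, ← Ideal.Quotient.eq_zero_iff_mem, hy] at hyI
    ext
    simpa using hyI
  obtain ⟨x, hx, hreg⟩ := IsSMulRegular.subsingleton_linearMap_iff.mp hsub
  exact ⟨x, by rwa [Ideal.annihilator_quotient] at hx, hreg⟩

theorem quotientIdeal_linearMap_ext {n : ℕ} {I J : Ideal S} {w : Fin n → S}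
    (hJ : J = Ideal.span (Set.range w)) {f g : quotientIdeal I J →ₗ[S ⧸ I] S ⧸ I}
    (h : ∀ i, f (quotientIdealMk I ⟨w i, hJ ▸ Ideal.subset_span (Set.mem_range_self i)⟩) =
      g (quotientIdealMk I ⟨w i, hJ ▸ Ideal.subset_span (Set.mem_range_self i)⟩)) : f = g := by
  have hmem : ∀ i, w i ∈ J := fun i ↦ hJ ▸ Ideal.subset_span (Set.mem_range_self i)
  refine LinearMap.ext fun ⟨u, hu⟩ ↦ ?_
  obtain ⟨u, hu', rfl⟩ := (Ideal.mem_map_iff_of_surjective _ Ideal.Quotient.mk_surjective).mp hu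
  rw [hJ] at hu'
  obtain ⟨q, rfl⟩ := Ideal.mem_span_range_iff_exists_fun.mp hu'
  have : (⟨Ideal.Quotient.mk I (∑ i, q i * w i), hu⟩ : quotientIdeal I J) =
      ∑ i, Ideal.Quotient.mk I (q i) • quotientIdealMk I ⟨w i, hmem i⟩ := by
    apply Subtype.ext
    simp [quotientIdealMk]
  rw [this]
  simp only [map_sum, map_smul, h]

/-- Cramer's rule for `Q` with one more row: the cofactors of the added row are the signed maximal
minors of `Q`, up to the global sign `(-1) ^ r`. -/
theorem det_mul_sub_signedMaximalMinors_mul_mem {r : ℕ} {Q : Matrix (Fin r) (Fin (r + 1)) S}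
    {M : Matrix (Fin (r + 1)) (Fin (r + 1)) S} (hM : ∀ i : Fin r, M i.castSucc = Q i)
    (w : Fin (r + 1) → S) {I : Ideal S} (hI : ∀ i, Q.mulVec w i ∈ I) (i : Fin (r + 1)) :
    M.det * w i - (-1) ^ r * signedMaximalMinors Q i * M.mulVec w (Fin.last r) ∈ I := by
  have h1 : M.det * w i = ∑ k, M.adjugate i k * M.mulVec w k := by
    have := congrFun (Matrix.mulVec_mulVec w M.adjugate M) i
    rw [Matrix.adjugate_mul, Matrix.smul_mulVec, Matrix.one_mulVec] at this
    simpa [Matrix.mulVec, dotProduct] using this.symm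
  have h2 : M.adjugate i (Fin.last r) = (-1) ^ r * signedMaximalMinors Q i := by
    have hQ : M.submatrix Fin.castSucc i.succAbove = Q.submatrix id i.succAbove :=
      Matrix.ext fun k l ↦ congrFun (hM k) _
    rw [Matrix.adjugate_fin_succ_eq_det_submatrix, Fin.succAbove_last, hQ, signedMaximalMinors,
      pow_add, mul_assoc, Fin.val_last]
  rw [h1, Fin.sum_univ_castSucc, h2, add_sub_cancel_right]
  refine Ideal.sum_mem _ fun k _ ↦ Ideal.mul_mem_left _ _ ?_
  rw [Matrix.mulVec, hM]
  exact hI k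

end

theorem mainTheorem5 {S : Type u} [CommRing S] [IsGorensteinLocalRing S] (r : ℕ)
    (v : Fin r → S) (w : Fin (r + 1) → S)
    (hv : RingTheory.Sequence.IsRegular S (List.ofFn v))
    (hw : RingTheory.Sequence.IsRegular S (List.ofFn w))
    (I J : Ideal S) (hI : I = Ideal.span (Set.range v)) (hJ : J = Ideal.span (Set.range w))
    (hIJ : I ≤ J)
    (Q : Matrix (Fin r) (Fin (r + 1)) S) (hQ : v = Q.mulVec w) :
    ∃ s : quotientIdeal I J →ₗ[S ⧸ I] S ⧸ I,
      (∀ i : Fin (r + 1),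
        s (quotientIdealMk I ⟨w i, hJ ▸ Ideal.subset_span (Set.mem_range_self i)⟩) =
          Ideal.Quotient.mk I (signedMaximalMinors Q i)) ∧
      (∀ s' : quotientIdeal I J →ₗ[S ⧸ I] S ⧸ I,
        (∀ i : Fin (r + 1),
          s' (quotientIdealMk I ⟨w i, hJ ▸ Ideal.subset_span (Set.mem_range_self i)⟩) =
            Ideal.Quotient.mk I (signedMaximalMinors Q i)) → s' = s) ∧
      Submodule.span (S ⧸ I) {(quotientIdeal I J).subtype, s} = ⊤ := by
  have hmem : ∀ i, w i ∈ J := fun i ↦ hJ ▸ Ideal.subset_span (Set.mem_range_self i)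
  obtain ⟨x, hxJ, hx⟩ := exists_isSMulRegular_quotient hv hw (hI ▸ hJ ▸ hIJ)
  rw [← hI] at hx
  have hxJ' : x ∈ J := hJ ▸ hxJ
  obtain ⟨q, hq⟩ := Ideal.mem_span_range_iff_exists_fun.mp hxJ
  obtain ⟨M, hMQ, hMq⟩ : ∃ M : Matrix (Fin (r + 1)) (Fin (r + 1)) S,
      (∀ i : Fin r, M i.castSucc = Q i) ∧ M (Fin.last r) = q :=
    ⟨Fin.snoc (α := fun _ ↦ Fin (r + 1) → S) Q q, fun i ↦ Fin.snoc_castSucc _ _ i,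
      Fin.snoc_last _ _⟩
  have hMx : M.mulVec w (Fin.last r) = x := by
    rw [Matrix.mulVec, hMq]
    exact hq
  let mk : S →+* S ⧸ I := Ideal.Quotient.mk I
  have hvI : ∀ i, Q.mulVec w i ∈ I := fun i ↦ by
    rw [← hQ, hI]
    exact Ideal.subset_span ⟨i, rfl⟩
  have hcancel : ∀ {y z : S ⧸ I}, mk x * y = mk x * z → y = z := fun {y z} h ↦
    hx h
  have hcramer : ∀ i, mk x * mk (signedMaximalMinors Q i) = mk ((-1) ^ r * M.det) * mk (w i) := by
    intro i
    have h := Ideal.Quotient.eq.mpr (det_mul_sub_signedMaximalMinors_mul_mem hMQ w hvI i)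
    rw [hMx] at h
    have hs : ((-1 : S) ^ r) * (-1) ^ r = 1 := by rw [← mul_pow]; simp
    calc mk x * mk (signedMaximalMinors Q i)
        = mk ((-1) ^ r) * mk ((-1) ^ r * signedMaximalMinors Q i * x) := by
          rw [← map_mul, ← map_mul]
          congr 1
          linear_combination (-(signedMaximalMinors Q i * x)) * hs
      _ = mk ((-1) ^ r * M.det) * mk (w i) := by
          rw [show mk ((-1) ^ r * signedMaximalMinors Q i * x) = mk (M.det * w i) from h.symm,
            ← map_mul, ← map_mul, mul_assoc]
  -- The map `s` is multiplication by `(-1) ^ r * det M` followed by division by `x`.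
  let L : (S ⧸ I) →ₗ[S ⧸ I] S ⧸ I := LinearMap.mulLeft (S ⧸ I) (mk x)
  have hL : Function.Injective L := fun y z h ↦ hcancel h
  have hrange : ∀ u : quotientIdeal I J,
      (mk ((-1) ^ r * M.det) • (quotientIdeal I J).subtype) u ∈ LinearMap.range L := by
    rintro ⟨u, hu⟩
    obtain ⟨u, hu', rfl⟩ := (Ideal.mem_map_iff_of_surjective _ Ideal.Quotient.mk_surjective).mp hu
    rw [hJ] at hu'
    obtain ⟨p, rfl⟩ := Ideal.mem_span_range_iff_exists_fun.mp hu'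
    refine ⟨∑ i, mk (p i) * mk (signedMaximalMinors Q i), ?_⟩
    change mk x * _ = mk ((-1) ^ r * M.det) * mk (∑ i, p i * w i)
    rw [map_sum, Finset.mul_sum, Finset.mul_sum]
    refine Finset.sum_congr rfl fun i _ ↦ ?_
    rw [map_mul mk (p i), mul_left_comm, hcramer, mul_left_comm]
  let s : quotientIdeal I J →ₗ[S ⧸ I] S ⧸ I :=
    (LinearEquiv.ofInjective L hL).symm.toLinearMap ∘ₗ LinearMap.codRestrict _ _ hrange
  have hs : ∀ u : quotientIdeal I J, mk x * s u = mk ((-1) ^ r * M.det) * u := fun u ↦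
    congrArg Subtype.val
      ((LinearEquiv.ofInjective L hL).apply_symm_apply (LinearMap.codRestrict _ _ hrange u))
  have hsw : ∀ i, s (quotientIdealMk I ⟨w i, hmem i⟩) = mk (signedMaximalMinors Q i) := fun i ↦
    hcancel ((hs _).trans (hcramer i).symm)
  refine ⟨s, hsw, fun s' hs' ↦ quotientIdeal_linearMap_ext hJ fun i ↦
    (hs' i).trans (hsw i).symm, eq_top_iff.mpr fun φ _ ↦ ?_⟩
  obtain ⟨y, hy⟩ := Ideal.Quotient.mk_surjective (φ (quotientIdealMk I ⟨x, hxJ'⟩))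
  -- Both sides are the value of `φ` at the product of `x` and `u`.
  have hcomm : ∀ u : quotientIdeal I J, mk x * φ u = u * mk y := fun u ↦ by
    have : mk x • u = (u : S ⧸ I) • quotientIdealMk I ⟨x, hxJ'⟩ := by
      apply Subtype.ext
      exact mul_comm _ _
    have := congrArg φ this
    rw [map_smul, map_smul, ← hy] at this
    exact this
  -- Wiebe's theorem is applied to `(v, x) = M w`.
  let a : Fin (r + 1) → S := Fin.snoc v x
  have hIa : Ideal.span (Set.range a) = I ⊔ Ideal.span {x} := by
    rw [Ideal.span_range_succ_last, hI]
    simp [a]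
  have ha : IsWeaklyRegular S (List.ofFn a) := by
    rw [isWeaklyRegular_ofFn_succ_last_iff]
    have ha' : (fun i : Fin r ↦ a i.castSucc) = v := funext fun i ↦ Fin.snoc_castSucc _ _ i
    rw [ha', ← hI, smul_eq_mul, Ideal.mul_top]
    exact ⟨hv.toIsWeaklyRegular, by simpa [a] using hx⟩
  have hJm : J ≤ maximalIdeal S := by
    rw [hJ, Ideal.span_le]
    rintro _ ⟨i, rfl⟩
    exact hw.mem_maximalIdeal i
  have hwiebe := mem_span_sup_det_smul_top_of_colon (N := S) M ha hw.toIsWeaklyRegular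
    (fun i ↦ by
      induction i using Fin.lastCases with
      | last => simpa [a] using hJm hxJ'
      | cast i => simpa [a] using hv.mem_maximalIdeal i)
    hw.mem_maximalIdeal
    (fun i z ↦ by
      congr 1
      induction i using Fin.lastCases with
      | last => simp [a, hMx]
      | cast i => simp [a, hQ, Matrix.mulVec, hMQ])
    (y := y) (fun b hb ↦ by
      rw [← hJ] at hb
      rw [hIa, mem_sup_span_singleton_smul_top_iff]
      obtain ⟨z, hz⟩ := Ideal.Quotient.mk_surjective (φ (quotientIdealMk I ⟨b, hb⟩))
      refine ⟨z, ?_⟩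
      have h := hcomm (quotientIdealMk I ⟨b, hb⟩)
      rw [← hz] at h
      rw [smul_eq_mul, smul_eq_mul, smul_eq_mul, Ideal.mul_top, ← Ideal.Quotient.eq, map_mul,
        map_mul]
      exact h.symm)
  rw [hIa, mem_sup_span_singleton_smul_top_iff] at hwiebe
  obtain ⟨β, hβ⟩ := hwiebe
  rw [mem_sup_span_singleton_smul_top_iff] at hβ
  obtain ⟨α, hα⟩ := hβ
  have hyαβ : mk y = mk x * mk α + mk M.det * mk β := by
    rw [← map_mul, ← map_mul, ← map_add]
    refine Ideal.Quotient.eq.mpr ?_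
    rw [smul_eq_mul, smul_eq_mul, smul_eq_mul, Ideal.mul_top] at hα
    convert hα using 1
    ring
  rw [Submodule.mem_span_pair]
  refine ⟨mk α, mk ((-1) ^ r * β), ?_⟩
  ext u
  refine hcancel ?_
  have hsgn : mk ((-1) ^ r) * mk ((-1) ^ r) = 1 := by
    rw [← map_mul, ← mul_pow]
    simp
  have hsu := hs u
  rw [map_mul] at hsu
  rw [hcomm, hyαβ]
  simp only [LinearMap.add_apply, LinearMap.smul_apply, Submodule.subtype_apply, smul_eq_mul,
    map_mul]
  linear_combination mk ((-1) ^ r) * mk β * hsu + mk M.det * mk β * u.1 * hsgn
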